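/- A one-way two-player one-clean-qubit protocol for a function $f:X\times Y\to\{0,1\}$ works as follows. The storage consists of finitely many qubits, one of which is in the state $|0\rangle$, while the other $m$ are totally mixed, so the initial state is $|0\rangle\langle 0|\otimes I/2^m$; each qubit is initially held by Alice or by Bob. On input $x$ Alice applies a unitary (depending on $x$) to her qubits and sends $c\ge 1$ of them to Bob. On input $y$ Bob applies a unitary (depending on $y$) to the received qubits and his own qubits, and performs on these qubits a two-outcome projective measurement that does not depend on the inputs, one outcome meaning acceptance. The protocol has bias $\epsilon>0$ for $f$ if there is a number $p$ with $0\le p-\epsilon$ and $p+\epsilon\le 1$ such that every $(x,y)$ with $f(x,y)=0$ is accepted with probability at most $p-\epsilon$ and every $(x,y)$ with $f(x,y)=1$ is accepted with probability at least $p+\epsilon$. Let $$Q_{[1]}^{A\to B}(f)=\inf \frac{c}{\epsilon^2},$$ the infimum being over all such protocols for $f$ with communication $c$ and bias $\epsilon$. Let $PP(f)$ be the minimum of $c-\lfloor\log_2\epsilon\rfloor$ over all classical two-way randomized private-coin protocols that, with communication at most $c$ bits, compute $f$ on every input with error at most $\frac12-\epsilon$, where $\epsilon>0$. (A protocol is a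 binary tree whose inner nodes are owned by Alice or Bob and whose leaves carry the output.) Theorem. There are absolute constants $a,b>0$ such that for all $n\ge 1$ and all $f:\{0,1\}^n\times\{0,1\}^n\to\{0,1\}$, $$Q_{[1]}^{A\to B}(f)\;\ge\;2^{\,a\cdot PP(f)-b\log_2 n}.$$ That is, $Q_{[1]}^{A\to B}(f)\ge 2^{\Omega(PP(f))-O(\log n)}$. -/

import Mathlib

noncomputable section

namespace OneCleanQubit

open scoped Kronecker Matrix

/-! ### One-way two-player protocols with one clean qubit -/

/-- Labels of the computational basis of a register of `k` qubits. -/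
abbrev Basis (k : ℕ) : Type := Fin k → Bool

/-- A one-way two-player protocol with one clean qubit.  The storage consists of `kept` qubits
that stay with Alice, `comm` qubits that Alice sends to Bob, and `priv` private qubits of Bob.
One of all these qubits is clean, all the others are totally mixed.  On input `x` Alice applies
`U x` to the qubits she holds, sends the message register, and on input `y` Bob applies `V y` to
the message and to his private qubits and performs on these qubits the projective measurement
`{M, 1 - M}`, which does not depend on the inputs; the outcome `M` means acceptance. -/
structure OneWayProtocol (X Y : Type) where
  kept : ℕ
  comm : ℕ
  priv : ℕ
  /-- Alice sends at least one qubit. -/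
  one_le_comm : 1 ≤ comm
  /-- The position of the clean qubit. -/
  clean : Fin kept ⊕ Fin comm ⊕ Fin priv
  U : X → Matrix.unitaryGroup (Basis kept × Basis comm) ℂ
  V : Y → Matrix.unitaryGroup (Basis comm × Basis priv) ℂ
  M : Matrix (Basis comm × Basis priv) (Basis comm × Basis priv) ℂ
  isProjection : IsStarProjection M

namespace OneWayProtocol

variable {X Y : Type} (P : OneWayProtocol X Y)

/-- Labels of the computational basis of the whole storage. -/
abbrev Total : Type := Basis P.kept × Basis P.comm × Basis P.priv

/-- The value of the clean qubit in a computational basis state of the whole storage. -/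
def cleanBit (s : P.Total) : Bool := Sum.elim s.1 (Sum.elim s.2.1 s.2.2) P.clean

/-- The number of totally mixed qubits: all qubits but one. -/
def mixed : ℕ := P.kept + P.comm + P.priv - 1

/-- The initial state `|0⟩⟨0| ⊗ I / 2 ^ m`, where the first factor is the clean qubit and `m` is
the number of the other qubits. -/
def initialState : Matrix P.Total P.Total ℂ :=
  Matrix.diagonal fun s => if P.cleanBit s = false then 1 / 2 ^ P.mixed else 0

/-- Alice's operation on the whole storage: `U x ⊗ I`. -/
def aliceOp (x : X) : Matrix P.Total P.Total ℂ :=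
  Matrix.reindex (Equiv.prodAssoc _ _ _) (Equiv.prodAssoc _ _ _)
    ((P.U x : Matrix _ _ ℂ) ⊗ₖ (1 : Matrix (Basis P.priv) (Basis P.priv) ℂ))

/-- Bob's operation on the whole storage: `I ⊗ V y`. -/
def bobOp (y : Y) : Matrix P.Total P.Total ℂ :=
  (1 : Matrix (Basis P.kept) (Basis P.kept) ℂ) ⊗ₖ (P.V y : Matrix _ _ ℂ)

/-- The state of the whole storage before the measurement. -/
def finalState (x : X) (y : Y) : Matrix P.Total P.Total ℂ :=
  (P.bobOp y * P.aliceOp x) * P.initialState * (P.bobOp y * P.aliceOp x)ᴴ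

/-- The acceptance probability `tr ((I ⊗ M) σ)` in the final state `σ` (a real number). -/
def acceptProb (x : X) (y : Y) : ℝ :=
  (((1 : Matrix (Basis P.kept) (Basis P.kept) ℂ) ⊗ₖ P.M) * P.finalState x y).trace.re

/-- The protocol computes `f` with bias `ε > 0`: for some threshold `p` with
`0 ≤ p - ε` and `p + ε ≤ 1`, every 0-input is accepted with probability at most `p - ε` and every
1-input with probability at least `p + ε`. -/
def ComputesWithBias (f : X → Y → Bool) (ε : ℝ) : Prop :=
  0 < ε ∧ ∃ p : ℝ, 0 ≤ p - ε ∧ p + ε ≤ 1 ∧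
    ∀ x y, (f x y = false → P.acceptProb x y ≤ p - ε) ∧
      (f x y = true → p + ε ≤ P.acceptProb x y)

end OneWayProtocol

/-- The one-way one-clean-qubit cost of `f`: the infimum of `c / ε ^ 2` over all one-way
one-clean-qubit protocols that compute `f` with bias `ε` and `c` qubits of communication. -/
def oneWayCost {X Y : Type} (f : X → Y → Bool) : ENNReal :=
  ⨅ (P : OneWayProtocol X Y) (ε : ℝ) (_ : P.ComputesWithBias f ε),
    ENNReal.ofReal ((P.comm : ℝ) / ε ^ 2)

/-! ### Weakly unbounded error protocols -/

/-- Deterministic two-way protocol trees: at an inner node its owner sends one bit, which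
determines the child at which the protocol continues; leaves are labelled with the output. -/
inductive ProtocolTree (S T : Type) : Type
  | leaf (z : Bool) : ProtocolTree S T
  | alice (g : S → Bool) (t₀ t₁ : ProtocolTree S T) : ProtocolTree S T
  | bob (g : T → Bool) (t₀ t₁ : ProtocolTree S T) : ProtocolTree S T

namespace ProtocolTree

variable {S T : Type}

/-- The output of the protocol. -/
def run : ProtocolTree S T → S → T → Bool
  | leaf z, _, _ => z
  | alice g t₀ t₁, s, t => if g s then t₁.run s t else t₀.run s t
  | bob g t₀ t₁, s, t => if g t then t₁.run s t else t₀.run s t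

/-- The maximal number of communicated bits. -/
def height : ProtocolTree S T → ℕ
  | leaf _ => 0
  | alice _ t₀ t₁ => max t₀.height t₁.height + 1
  | bob _ t₀ t₁ => max t₀.height t₁.height + 1

end ProtocolTree

/-- A randomized two-way private coin protocol: Alice and Bob draw their random strings
independently, each from a finite probability space known to its owner only, and then run a
deterministic protocol in which the bits of a player depend on the input and the random string
of this player. -/
structure PrivateCoinProtocol (X Y : Type) where
  coinsA : ℕ
  coinsB : ℕ
  distA : Fin coinsA → ℝ
  distB : Fin coinsB → ℝ
  distA_mem : distA ∈ stdSimplex ℝ (Fin coinsA)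
  distB_mem : distB ∈ stdSimplex ℝ (Fin coinsB)
  tree : ProtocolTree (X × Fin coinsA) (Y × Fin coinsB)

namespace PrivateCoinProtocol

variable {X Y : Type} (P : PrivateCoinProtocol X Y)

/-- The probability that the output on input `(x, y)` is `z`. -/
def outputProb (x : X) (y : Y) (z : Bool) : ℝ :=
  ∑ r, ∑ s, P.distA r * P.distB s * if P.tree.run (x, r) (y, s) = z then 1 else 0

/-- On every input the error is at most `1 / 2 - ε`, where `ε > 0`. -/
def ComputesWithBias (f : X → Y → Bool) (ε : ℝ) : Prop :=
  0 < ε ∧ ∀ x y, 1 / 2 + ε ≤ P.outputProb x y (f x y)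

end PrivateCoinProtocol

/-- The weakly unbounded error communication complexity `PP(f)`: the minimum of
`c - ⌊log₂ ε⌋` over all private coin protocols for `f` with communication `c` and error at most
`1 / 2 - ε`. -/
def PP {X Y : Type} (f : X → Y → Bool) : ℤ :=
  sInf {k : ℤ | ∃ (P : PrivateCoinProtocol X Y) (ε : ℝ), P.ComputesWithBias f ε ∧
    k = (P.tree.height : ℤ) - ⌊Real.logb 2 ε⌋}

end OneCleanQubit

end

/-!
The lower bound holds because the acceptance probabilities of a protocol with one clean qubit are,
up to an additive constant, inner products of vectors of norm at most one, whatever the number of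
qubits sent. The initial state is `(I + Z) / 2 ^ k`, where `Z` is `σ_z` on the clean qubit and `k`
is the number of qubits. The identity contributes a constant, the acceptance probability in the
totally mixed state. The contribution of `Z` is the pairing of two operators on the message
register, one depending on `x` and the other on `y`; the product of their Frobenius norms is at
most `2 ^ k`, which the normalization cancels (`OneWayProtocol.exists_vectors`). So a protocol with
bias `ε` represents `f` with margin `ε` in a space whose dimension plays no role.

Such a representation yields a classical protocol. First, for every weight on the inputs there is
a rank one sign matrix whose correlation with `f` is at least `ε ^ 3 / 64`
(`exists_sgn_of_computesWithBias`): this is a weak form of Grothendieck's inequality, proved by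
projecting the vectors to a random sign vector, truncating the projections, whose fourth moments
are bounded, and rounding to signs (`exists_sgn_sum_inner_le`). Second, exponential weights turn
this into a list of polynomially many, in `n` and `1 / ε`, rank one sign matrices whose average
correlates with `f` at every input (`exists_sgn_list`). Third, Alice draws an index into the list
privately and sends it, and the players exchange the two signs that belong to their inputs
(`listProtocol`). Communication and logarithm of the bias are of order `log n + log (1 / ε)`
(`PP_le_of_computesWithBias`). As `c ≥ 1` and `ε ≤ 1 / 2`, the cost `c / ε ^ 2` is at least
`1 / ε ^ 2 ≥ 4`, which absorbs the additive constants.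
-/

namespace OneCleanQubit

open scoped Kronecker Matrix

/-! ### Random signs and a truncated Grothendieck inequality -/

/-- The real sign `±1` encoded by a bit; `true` stands for `1`. -/
def sgn (b : Bool) : ℝ := if b then 1 else -1

lemma sgn_not (b : Bool) : sgn (!b) = -sgn b := by cases b <;> simp [sgn]

lemma sgn_mul_self (b : Bool) : sgn b * sgn b = 1 := by cases b <;> simp [sgn]

lemma abs_sgn (b : Bool) : |sgn b| = 1 := by cases b <;> simp [sgn]

section Rademacher

variable {I : Type*} [DecidableEq I]

/-- The involution of the cube of sign patterns that flips the sign at position `j`. -/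
def flipAt (j : I) : Equiv.Perm (I → Bool) where
  toFun s := Function.update s j (!s j)
  invFun s := Function.update s j (!s j)
  left_inv s := by simp
  right_inv s := by simp

lemma flipAt_apply_self (j : I) (s : I → Bool) : flipAt j s j = !s j := by
  simp [flipAt]

lemma flipAt_apply_of_ne {i j : I} (h : i ≠ j) (s : I → Bool) : flipAt j s i = s i := by
  simp [flipAt, h]

/-- The unnormalized random variable `∑ i ∈ J, ± a i`. -/
def signSum (J : Finset I) (a : I → ℝ) (s : I → Bool) : ℝ := ∑ i ∈ J, sgn (s i) * a i

lemma signSum_flipAt {J : Finset I} {j : I} (hj : j ∉ J) (a : I → ℝ) (s : I → Bool) :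
    signSum J a (flipAt j s) = signSum J a s :=
  Finset.sum_congr rfl fun i hi => by
    rw [flipAt_apply_of_ne (ne_of_mem_of_not_mem hi hj)]

lemma signSum_insert {J : Finset I} {j : I} (hj : j ∉ J) (a : I → ℝ) (s : I → Bool) :
    signSum (insert j J) a s = sgn (s j) * a j + signSum J a s := by
  simp [signSum, Finset.sum_insert hj]

variable [Fintype I]

lemma sum_sgn_mul_eq_zero (j : I) (F : (I → Bool) → ℝ) (hF : ∀ s, F (flipAt j s) = F s) :
    ∑ s, sgn (s j) * F s = 0 := by
  have h := Equiv.sum_comp (flipAt j) fun s => sgn (s j) * F s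
  simp only [flipAt_apply_self, sgn_not, hF, neg_mul, Finset.sum_neg_distrib] at h
  linarith

/-- Random signs are orthonormal. -/
lemma sum_signSum_mul_signSum (J : Finset I) (a b : I → ℝ) :
    ∑ s, signSum J a s * signSum J b s = 2 ^ Fintype.card I * ∑ i ∈ J, a i * b i := by
  induction J using Finset.induction_on with
  | empty => simp [signSum]
  | insert j J hj ih =>
    have h1 := sum_sgn_mul_eq_zero j
      (fun s => a j * signSum J b s + b j * signSum J a s) fun s => by
        simp only [signSum_flipAt hj]
    have h2 : ∀ s : I → Bool, signSum (insert j J) a s * signSum (insert j J) b s =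
        a j * b j + sgn (s j) * (a j * signSum J b s + b j * signSum J a s)
          + signSum J a s * signSum J b s := fun s => by
      rw [signSum_insert hj, signSum_insert hj]
      linear_combination (a j * b j) * sgn_mul_self (s j)
    simp only [h2, Finset.sum_add_distrib, h1, ih, Finset.sum_insert hj, Finset.sum_const,
      Finset.card_univ, Fintype.card_fun, Fintype.card_bool, nsmul_eq_mul]
    push_cast
    ring

/-- Khinchine's inequality for the fourth moment. -/
lemma sum_signSum_pow_four_le (J : Finset I) (a : I → ℝ) :
    ∑ s, signSum J a s ^ 4 ≤ 2 ^ Fintype.card I * (3 * (∑ i ∈ J, a i ^ 2) ^ 2) := by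
  induction J using Finset.induction_on with
  | empty => simp [signSum]
  | insert j J hj ih =>
    have h1 := sum_sgn_mul_eq_zero j
      (fun s => 4 * a j * signSum J a s ^ 3 + 4 * a j ^ 3 * signSum J a s) fun s => by
        simp only [signSum_flipAt hj]
    have h2 : ∀ s : I → Bool, signSum (insert j J) a s ^ 4 =
        a j ^ 4 + sgn (s j) * (4 * a j * signSum J a s ^ 3 + 4 * a j ^ 3 * signSum J a s)
          + 6 * a j ^ 2 * (signSum J a s * signSum J a s) + signSum J a s ^ 4 := fun s => by
      rw [signSum_insert hj]
      have := sgn_mul_self (s j)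
      cases s j <;> simp only [sgn] <;> norm_num <;> ring
    simp only [h2, Finset.sum_add_distrib, h1, Finset.sum_insert hj, Finset.sum_const,
      Finset.card_univ, Fintype.card_fun, Fintype.card_bool, nsmul_eq_mul, ← Finset.mul_sum,
      sum_signSum_mul_signSum]
    push_cast
    have h3 : ∑ i ∈ J, a i * a i = ∑ i ∈ J, a i ^ 2 := by simp only [sq]
    rw [h3]
    have h4 : (0 : ℝ) ≤ 2 ^ Fintype.card I * a j ^ 4 := by positivity
    nlinarith

end Rademacher

/-- Truncation of a real number to the interval `[-T, T]`. -/
def clip (T u : ℝ) : ℝ := max (-T) (min u T)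

lemma abs_clip_le {T : ℝ} (hT : 0 < T) (u : ℝ) : |clip T u| ≤ T := by
  unfold clip
  rw [abs_le]
  exact ⟨le_max_left _ _, max_le (by linarith) (min_le_right _ _)⟩

lemma abs_clip_le_abs {T : ℝ} (hT : 0 < T) (u : ℝ) : |clip T u| ≤ |u| := by
  unfold clip
  rw [abs_le]
  refine ⟨le_trans (le_min (neg_abs_le u) ?_) (le_max_right _ _),
    max_le ?_ ((min_le_left _ _).trans (le_abs_self u))⟩ <;> linarith [abs_nonneg u]

/-- By the inequality of the arithmetic and geometric means, `|u| - T ≤ u ^ 2 / (4 T)`. -/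
lemma abs_sub_clip_le {T : ℝ} (hT : 0 < T) (u : ℝ) : |u - clip T u| ≤ u ^ 2 / (4 * T) := by
  rw [le_div_iff₀ (by positivity)]
  unfold clip
  rcases le_total u T with h | h
  · rw [min_eq_left h]
    rcases le_total (-T) u with h' | h'
    · rw [max_eq_right h']
      simp only [sub_self, abs_zero, zero_mul]
      positivity
    · rw [max_eq_left h', abs_of_nonpos (by linarith)]
      nlinarith [sq_nonneg (u + 2 * T)]
  · rw [min_eq_right h, max_eq_right (by linarith), abs_of_nonneg (by linarith)]
    nlinarith [sq_nonneg (u - 2 * T)]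

lemma mul_sub_clip_mul_clip_le {T : ℝ} (hT : 0 < T) (u v : ℝ) :
    |u * v - clip T u * clip T v| ≤ (u ^ 2 + u ^ 4 + v ^ 2 + v ^ 4) / (8 * T) := by
  have h : u * v - clip T u * clip T v = u * (v - clip T v) + clip T v * (u - clip T u) := by
    ring
  rw [h]
  refine (abs_add_le _ _).trans ?_
  rw [abs_mul, abs_mul]
  have h1 : |u| * |v - clip T v| ≤ |u| * (v ^ 2 / (4 * T)) :=
    mul_le_mul_of_nonneg_left (abs_sub_clip_le hT v) (abs_nonneg u)
  have h2 : |clip T v| * |u - clip T u| ≤ |v| * (u ^ 2 / (4 * T)) :=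
    mul_le_mul (abs_clip_le_abs hT v) (abs_sub_clip_le hT u) (abs_nonneg _) (abs_nonneg _)
  have h3 : |u| * v ^ 2 ≤ (u ^ 2 + v ^ 4) / 2 := by
    nlinarith [sq_nonneg (|u| - v ^ 2), sq_abs u]
  have h4 : |v| * u ^ 2 ≤ (v ^ 2 + u ^ 4) / 2 := by
    nlinarith [sq_nonneg (|v| - u ^ 2), sq_abs v]
  calc |u| * |v - clip T v| + |clip T v| * |u - clip T u|
      ≤ (|u| * v ^ 2 + |v| * u ^ 2) / (4 * T) := by
        rw [add_div, mul_div_assoc, mul_div_assoc]; linarith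
    _ ≤ ((u ^ 2 + v ^ 4) / 2 + (v ^ 2 + u ^ 4) / 2) / (4 * T) := by gcongr
    _ = (u ^ 2 + u ^ 4 + v ^ 2 + v ^ 4) / (8 * T) := by field_simp; ring

section Grothendieck

variable {X Y I : Type*} [Fintype X] [Fintype Y] [Fintype I]

/-- A linear form on the cube `[-T, T] ^ X` is maximal at a vertex. -/
lemma exists_sgn_linear_le {T : ℝ} (g u : X → ℝ) (hu : ∀ x, |u x| ≤ T) :
    ∃ a : X → Bool, ∑ x, u x * g x ≤ T * ∑ x, sgn (a x) * g x := by
  refine ⟨fun x => decide (0 ≤ g x), ?_⟩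
  rw [Finset.mul_sum]
  refine Finset.sum_le_sum fun x _ => ?_
  have h : sgn (decide (0 ≤ g x)) * g x = |g x| := by
    by_cases h : 0 ≤ g x
    · simp [sgn, h, abs_of_nonneg]
    · simp [sgn, h, abs_of_neg (not_le.mp h)]
  rw [h]
  calc u x * g x ≤ |u x| * |g x| := by rw [← abs_mul]; exact le_abs_self _
    _ ≤ T * |g x| := mul_le_mul_of_nonneg_right (hu x) (abs_nonneg _)

lemma exists_sgn_bilinear_le {T : ℝ} (hT : 0 < T) (G : X → Y → ℝ) (u : X → ℝ) (v : Y → ℝ)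
    (hu : ∀ x, |u x| ≤ T) (hv : ∀ y, |v y| ≤ T) :
    ∃ (a : X → Bool) (b : Y → Bool),
      ∑ x, ∑ y, G x y * (u x * v y) ≤ T ^ 2 * ∑ x, ∑ y, G x y * (sgn (a x) * sgn (b y)) := by
  obtain ⟨a, ha⟩ := exists_sgn_linear_le (fun x => ∑ y, G x y * v y) u hu
  obtain ⟨b, hb⟩ := exists_sgn_linear_le (fun y => ∑ x, G x y * sgn (a x)) v hv
  refine ⟨a, b, ?_⟩
  have h1 : ∑ x, ∑ y, G x y * (u x * v y) = ∑ x, u x * ∑ y, G x y * v y := by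
    simp only [Finset.mul_sum]
    exact Finset.sum_congr rfl fun x _ => Finset.sum_congr rfl fun y _ => by ring
  have h2 : ∑ x, sgn (a x) * ∑ y, G x y * v y = ∑ y, v y * ∑ x, G x y * sgn (a x) := by
    simp only [Finset.mul_sum]
    rw [Finset.sum_comm]
    exact Finset.sum_congr rfl fun x _ => Finset.sum_congr rfl fun y _ => by ring
  have h3 : ∑ y, sgn (b y) * ∑ x, G x y * sgn (a x) =
      ∑ x, ∑ y, G x y * (sgn (a x) * sgn (b y)) := by
    simp only [Finset.mul_sum]
    rw [Finset.sum_comm]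
    exact Finset.sum_congr rfl fun x _ => Finset.sum_congr rfl fun y _ => by ring
  rw [h2] at ha
  rw [h3] at hb
  rw [h1, sq, mul_assoc]
  exact ha.trans (mul_le_mul_of_nonneg_left hb hT.le)

/-- A weak form of Grothendieck's inequality: random signs replace the unit vectors `α x` and
`β y` by real numbers with the right correlation, which are then truncated at `T` and rounded to
the vertices of the cube. The fourth moments bound the cost of truncation, whatever the dimension
of the vectors. -/
theorem exists_sgn_sum_inner_le {T : ℝ} (hT : 0 < T) (G : X → Y → ℝ)
    (α : X → I → ℝ) (β : Y → I → ℝ) (hα : ∀ x, ∑ i, α x i ^ 2 ≤ 1)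
    (hβ : ∀ y, ∑ i, β y i ^ 2 ≤ 1) :
    ∃ (a : X → Bool) (b : Y → Bool), ∑ x, ∑ y, G x y * ∑ i, α x i * β y i ≤
      T ^ 2 * ∑ x, ∑ y, G x y * (sgn (a x) * sgn (b y)) + (∑ x, ∑ y, |G x y|) / T := by
  classical
  set D : ℝ := 2 ^ Fintype.card I with hD
  have hD0 : 0 < D := by positivity
  set S : (I → ℝ) → (I → Bool) → ℝ := signSum Finset.univ with hS
  have hmom : ∀ w : I → ℝ, ∑ i, w i ^ 2 ≤ 1 → ∑ s, (S w s ^ 2 + S w s ^ 4) ≤ 4 * D := by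
    intro w hw
    have h0 : 0 ≤ ∑ i, w i ^ 2 := Finset.sum_nonneg fun i _ => sq_nonneg _
    have h2 := sum_signSum_mul_signSum Finset.univ w w
    have h4 := sum_signSum_pow_four_le Finset.univ w
    simp only [← sq] at h2
    rw [Finset.sum_add_distrib]
    have h5 : D * ∑ i, w i ^ 2 ≤ D * 1 := mul_le_mul_of_nonneg_left hw hD0.le
    have h6 : D * (3 * (∑ i, w i ^ 2) ^ 2) ≤ D * (3 * 1) :=
      mul_le_mul_of_nonneg_left (by nlinarith) hD0.le
    linarith
  -- Truncation changes each expected product by at most `1 / T`.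
  have hpair : ∀ x y, G x y * (D * ∑ i, α x i * β y i) ≤
      ∑ s, G x y * (clip T (S (α x) s) * clip T (S (β y) s)) + |G x y| * (D / T) := by
    intro x y
    rw [hD, ← sum_signSum_mul_signSum, ← hD, ← Finset.mul_sum]
    have h1 : |∑ s, S (α x) s * S (β y) s - ∑ s, clip T (S (α x) s) * clip T (S (β y) s)|
        ≤ D / T := by
      rw [← Finset.sum_sub_distrib]
      calc _ ≤ ∑ s, |S (α x) s * S (β y) s - clip T (S (α x) s) * clip T (S (β y) s)| :=
            Finset.abs_sum_le_sum_abs _ _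
        _ ≤ ∑ s, ((S (α x) s ^ 2 + S (α x) s ^ 4) + (S (β y) s ^ 2 + S (β y) s ^ 4)) / (8 * T) :=
            Finset.sum_le_sum fun s _ =>
              (mul_sub_clip_mul_clip_le hT _ _).trans (le_of_eq (by ring))
        _ = (∑ s, (S (α x) s ^ 2 + S (α x) s ^ 4) + ∑ s, (S (β y) s ^ 2 + S (β y) s ^ 4))
              / (8 * T) := by rw [← Finset.sum_div, Finset.sum_add_distrib]
        _ ≤ (4 * D + 4 * D) / (8 * T) := by
            gcongr
            · exact hmom _ (hα x)
            · exact hmom _ (hβ y)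
        _ = D / T := by field_simp; ring
    have h2 := mul_le_mul_of_nonneg_left h1 (abs_nonneg (G x y))
    rw [← abs_mul] at h2
    have h3 := (le_abs_self _).trans h2
    linarith
  have havg : D * ∑ x, ∑ y, G x y * ∑ i, α x i * β y i ≤
      ∑ s, (∑ x, ∑ y, G x y * (clip T (S (α x) s) * clip T (S (β y) s))
        + (∑ x, ∑ y, |G x y|) / T) := by
    have e1 : D * ∑ x, ∑ y, G x y * ∑ i, α x i * β y i =
        ∑ x, ∑ y, G x y * (D * ∑ i, α x i * β y i) := by
      rw [Finset.mul_sum]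
      refine Finset.sum_congr rfl fun x _ => ?_
      rw [Finset.mul_sum]
      exact Finset.sum_congr rfl fun y _ => mul_left_comm _ _ _
    have e2 : ∑ s, ∑ x, ∑ y, G x y * (clip T (S (α x) s) * clip T (S (β y) s)) =
        ∑ x, ∑ y, ∑ s, G x y * (clip T (S (α x) s) * clip T (S (β y) s)) := by
      rw [Finset.sum_comm]
      exact Finset.sum_congr rfl fun x _ => Finset.sum_comm
    have e3 : D * ((∑ x, ∑ y, |G x y|) / T) = ∑ x, ∑ y, |G x y| * (D / T) := by
      simp only [← Finset.sum_mul]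
      ring
    rw [Finset.sum_add_distrib, Finset.sum_const, Finset.card_univ, Fintype.card_fun,
      Fintype.card_bool, nsmul_eq_mul]
    push_cast
    rw [← hD, e1, e2, e3]
    simp only [← Finset.sum_add_distrib]
    exact Finset.sum_le_sum fun x _ => Finset.sum_le_sum fun y _ => hpair x y
  obtain ⟨s, -, hs⟩ : ∃ s ∈ (Finset.univ : Finset (I → Bool)),
      ∑ x, ∑ y, G x y * ∑ i, α x i * β y i ≤
        ∑ x, ∑ y, G x y * (clip T (S (α x) s) * clip T (S (β y) s))
          + (∑ x, ∑ y, |G x y|) / T := by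
    refine Finset.exists_le_of_sum_le Finset.univ_nonempty ?_
    rw [Finset.sum_const, Finset.card_univ, Fintype.card_fun, Fintype.card_bool, nsmul_eq_mul]
    push_cast
    exact havg
  obtain ⟨a, b, hab⟩ := exists_sgn_bilinear_le hT G (fun x => clip T (S (α x) s))
    (fun y => clip T (S (β y) s)) (fun x => abs_clip_le hT _) fun y => abs_clip_le hT _
  exact ⟨a, b, by linarith⟩

end Grothendieck

/-! ### The acceptance probability as an inner product of short vectors -/

section Frobenius

variable {ι κ μ : Type*} [Fintype ι] [Fintype κ] [Fintype μ]

lemma trace_mul_conjTranspose_re (A : Matrix ι κ ℂ) :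
    (A * Aᴴ).trace.re = ∑ i, ∑ j, ‖A i j‖ ^ 2 := by
  simp only [Matrix.trace, Matrix.diag, Matrix.mul_apply, Matrix.conjTranspose_apply,
    Complex.re_sum]
  refine Finset.sum_congr rfl fun i _ => Finset.sum_congr rfl fun j _ => ?_
  rw [← Complex.normSq_eq_norm_sq, Complex.star_def, Complex.mul_conj, Complex.ofReal_re]

/-- Conjugation by a unitary matrix preserves the Frobenius norm. -/
lemma sum_norm_sq_conj [DecidableEq ι] (U : Matrix ι ι ℂ) (hU : Uᴴ * U = 1) (A : Matrix ι ι ℂ) :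
    ∑ i, ∑ j, ‖(U * A * Uᴴ) i j‖ ^ 2 = ∑ i, ∑ j, ‖A i j‖ ^ 2 := by
  rw [← trace_mul_conjTranspose_re, ← trace_mul_conjTranspose_re]
  have h : U * A * Uᴴ * (U * A * Uᴴ)ᴴ = U * (A * Aᴴ * Uᴴ) := by
    simp only [Matrix.conjTranspose_mul, Matrix.conjTranspose_conjTranspose, Matrix.mul_assoc]
    rw [← Matrix.mul_assoc Uᴴ U, hU, Matrix.one_mul]
  rw [h, Matrix.trace_mul_comm, Matrix.mul_assoc, hU, Matrix.mul_one]

lemma sum_norm_sq_projection_eq {M : Matrix ι ι ℂ} (hM : IsStarProjection M) :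
    ∑ i, ∑ j, ‖M i j‖ ^ 2 = M.trace.re := by
  have h1 : Mᴴ = M := hM.isSelfAdjoint
  have h2 : M * M = M := hM.isIdempotentElem
  rw [← trace_mul_conjTranspose_re, h1, h2]

lemma trace_projection_re_nonneg {M : Matrix ι ι ℂ} (hM : IsStarProjection M) :
    0 ≤ M.trace.re := by
  rw [← sum_norm_sq_projection_eq hM]
  positivity

lemma trace_projection_re_le [DecidableEq ι] {M : Matrix ι ι ℂ} (hM : IsStarProjection M) :
    M.trace.re ≤ Fintype.card ι := by
  have h := trace_projection_re_nonneg hM.one_sub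
  rw [Matrix.trace_sub, Matrix.trace_one] at h
  simpa using h

lemma unitary_mul_conjTranspose [DecidableEq ι] (U : Matrix.unitaryGroup ι ℂ) :
    (U : Matrix ι ι ℂ) * (U : Matrix ι ι ℂ)ᴴ = 1 :=
  Matrix.mem_unitaryGroup_iff.mp U.2

lemma conjTranspose_mul_unitary [DecidableEq ι] (U : Matrix.unitaryGroup ι ℂ) :
    (U : Matrix ι ι ℂ)ᴴ * (U : Matrix ι ι ℂ) = 1 :=
  Matrix.mem_unitaryGroup_iff'.mp U.2

lemma norm_sum_sq_le (z : μ → ℂ) : ‖∑ k, z k‖ ^ 2 ≤ Fintype.card μ * ∑ k, ‖z k‖ ^ 2 := by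
  calc ‖∑ k, z k‖ ^ 2 ≤ (∑ k, ‖z k‖) ^ 2 := by gcongr; exact norm_sum_le _ _
    _ ≤ _ := by simpa using sq_sum_le_card_mul_sum_sq (s := Finset.univ) (f := fun k => ‖z k‖)

/-- A (weighted) partial trace over the second factor increases the Frobenius norm at most by the
square root of the dimension of this factor. -/
lemma sum_norm_sq_partialTrace_le (A : Matrix (κ × μ) (κ × μ) ℂ) (z : μ → ℂ)
    (hz : ∀ k, ‖z k‖ = 1) :
    ∑ i, ∑ j, ‖∑ k, A (i, k) (j, k) * z k‖ ^ 2 ≤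
      Fintype.card μ * ∑ i, ∑ j, ‖A i j‖ ^ 2 := by
  calc ∑ i, ∑ j, ‖∑ k, A (i, k) (j, k) * z k‖ ^ 2
      ≤ ∑ i, ∑ j, Fintype.card μ * ∑ k, ‖A (i, k) (j, k)‖ ^ 2 := by
        refine Finset.sum_le_sum fun i _ => Finset.sum_le_sum fun j _ => ?_
        refine (norm_sum_sq_le _).trans (le_of_eq ?_)
        simp only [norm_mul, hz, mul_one]
    _ = Fintype.card μ * ∑ i, ∑ k, ∑ j, ‖A (i, k) (j, k)‖ ^ 2 := by
        simp only [← Finset.mul_sum]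
        congr 1
        exact Finset.sum_congr rfl fun i _ => Finset.sum_comm
    _ ≤ Fintype.card μ * ∑ i, ∑ j, ‖A i j‖ ^ 2 := by
        simp only [Fintype.sum_prod_type]
        refine mul_le_mul_of_nonneg_left ?_ (Nat.cast_nonneg _)
        refine Finset.sum_le_sum fun i _ => Finset.sum_le_sum fun k _ =>
          Finset.sum_le_sum fun j _ => ?_
        exact Finset.single_le_sum (f := fun l => ‖A (i, k) (j, l)‖ ^ 2)
          (fun l _ => sq_nonneg _) (Finset.mem_univ k)

end Frobenius

section Trace

variable {K C Q : Type*} [Fintype K] [Fintype C] [Fintype Q] [DecidableEq K]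
  [DecidableEq Q]

/-- Only the overlapping register `C` matters when an operator on `C × Q` is paired with one that
is a product of an operator on `K × C` and a diagonal operator on `Q`. -/
lemma trace_kronecker_mul_reindex (N : Matrix (C × Q) (C × Q) ℂ) (R : Matrix (K × C) (K × C) ℂ)
    (z : Q → ℂ) :
    (((1 : Matrix K K ℂ) ⊗ₖ N) * Matrix.reindex (Equiv.prodAssoc K C Q) (Equiv.prodAssoc K C Q)
        (R ⊗ₖ Matrix.diagonal z)).trace =
      ∑ c, ∑ d, (∑ q, N (c, q) (d, q) * z q) * ∑ k, R (k, d) (k, c) := by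
  simp only [Matrix.trace, Matrix.diag, Matrix.mul_apply, Fintype.sum_prod_type,
    Matrix.kroneckerMap_apply, Matrix.reindex_apply, Matrix.submatrix_apply,
    Equiv.prodAssoc_symm_apply, Matrix.one_apply, Matrix.diagonal_apply, ite_mul, one_mul,
    zero_mul, mul_ite, mul_zero, Finset.sum_ite_eq', Finset.mem_univ, if_true, Finset.sum_mul,
    Finset.mul_sum]
  simp only [Finset.sum_ite_irrel, Finset.sum_const_zero, Finset.sum_ite_eq, Finset.mem_univ,
    if_true]
  rw [Finset.sum_comm]
  refine Finset.sum_congr rfl fun c _ => ?_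
  symm
  rw [Finset.sum_comm]
  refine Finset.sum_congr rfl fun k _ => ?_
  rw [Finset.sum_comm]
  refine Finset.sum_congr rfl fun q _ => Finset.sum_congr rfl fun d _ => ?_
  ring

end Trace

namespace OneWayProtocol

variable {X Y : Type} (P : OneWayProtocol X Y)

/-- The eigenvalue `±1` of the Pauli operator `σ_z` in the basis state `b` of a qubit. -/
def pauliSign (b : Bool) : ℂ := if b then -1 else 1

lemma norm_pauliSign (b : Bool) : ‖pauliSign b‖ = 1 := by cases b <;> simp [pauliSign]

/-- The diagonal of `σ_z` on the clean qubit if Alice holds it, of the identity otherwise. -/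
def aliceSign (s : Basis P.kept × Basis P.comm) : ℂ :=
  match P.clean with
  | Sum.inl i => pauliSign (s.1 i)
  | Sum.inr (Sum.inl i) => pauliSign (s.2 i)
  | Sum.inr (Sum.inr _) => 1

/-- The diagonal of `σ_z` on the clean qubit if Bob holds it, of the identity otherwise. -/
def bobSign (q : Basis P.priv) : ℂ :=
  match P.clean with
  | Sum.inl _ => 1
  | Sum.inr (Sum.inl _) => 1
  | Sum.inr (Sum.inr i) => pauliSign (q i)

lemma norm_aliceSign (s : Basis P.kept × Basis P.comm) : ‖P.aliceSign s‖ = 1 := by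
  unfold aliceSign
  split <;> simp [norm_pauliSign]

lemma norm_bobSign (q : Basis P.priv) : ‖P.bobSign q‖ = 1 := by
  unfold bobSign
  split <;> simp [norm_pauliSign]

lemma aliceSign_mul_bobSign (k : Basis P.kept) (c : Basis P.comm) (q : Basis P.priv) :
    P.aliceSign (k, c) * P.bobSign q = pauliSign (P.cleanBit (k, c, q)) := by
  unfold aliceSign bobSign cleanBit
  rcases P.clean with i | i | i <;> simp

lemma mixed_add_one : P.mixed + 1 = P.kept + P.comm + P.priv := by
  have := P.one_le_comm
  unfold mixed
  omega

/-- The initial state is `(I + Z) / 2 ^ k`, where `k` is the number of qubits and `Z` acts as `σ_z`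
on the clean qubit and trivially on the others; `Z` is a product operator. -/
lemma initialState_eq : P.initialState = ((1 / 2 ^ (P.kept + P.comm + P.priv) : ℂ)) •
    (1 + Matrix.reindex (Equiv.prodAssoc _ _ _) (Equiv.prodAssoc _ _ _)
      (Matrix.diagonal P.aliceSign ⊗ₖ Matrix.diagonal P.bobSign)) := by
  rw [← mixed_add_one, Matrix.diagonal_kronecker_diagonal, Matrix.reindex_apply,
    Matrix.submatrix_diagonal_equiv, ← Matrix.diagonal_one, Matrix.diagonal_add,
    ← Matrix.diagonal_smul]
  unfold initialState
  congr 1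
  funext ⟨k, c, q⟩
  simp only [Pi.smul_apply, Function.comp, Equiv.prodAssoc_symm_apply, smul_eq_mul,
    aliceSign_mul_bobSign]
  cases P.cleanBit (k, c, q)
  · simp [pauliSign, pow_succ]
    norm_num
    field_simp
  · simp [pauliSign]

/-- Alice's operator `U x Z (U x)ᴴ`. -/
def aliceMatrix (x : X) : Matrix (Basis P.kept × Basis P.comm) (Basis P.kept × Basis P.comm) ℂ :=
  (P.U x : Matrix _ _ ℂ) * Matrix.diagonal P.aliceSign * (P.U x : Matrix _ _ ℂ)ᴴ

/-- Bob's measurement operator before his unitary, `(V y)ᴴ M (V y)`. -/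
def bobMatrix (y : Y) : Matrix (Basis P.comm × Basis P.priv) (Basis P.comm × Basis P.priv) ℂ :=
  (P.V y : Matrix _ _ ℂ)ᴴ * P.M * (P.V y : Matrix _ _ ℂ)

lemma conj_initialState (x : X) : P.aliceOp x * P.initialState * (P.aliceOp x)ᴴ =
    ((1 / 2 ^ (P.kept + P.comm + P.priv) : ℂ)) •
    (1 + Matrix.reindex (Equiv.prodAssoc _ _ _) (Equiv.prodAssoc _ _ _)
      (P.aliceMatrix x ⊗ₖ Matrix.diagonal P.bobSign)) := by
  have hU := unitary_mul_conjTranspose (P.U x)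
  rw [initialState_eq, Matrix.mul_smul, Matrix.smul_mul, Matrix.mul_add, Matrix.add_mul,
    Matrix.mul_one]
  congr 2
  · unfold aliceOp
    rw [Matrix.conjTranspose_reindex, Matrix.conjTranspose_kronecker, Matrix.reindex_apply,
      Matrix.reindex_apply, Matrix.submatrix_mul_equiv, ← Matrix.mul_kronecker_mul, hU]
    simp
  · unfold aliceOp aliceMatrix
    rw [Matrix.conjTranspose_reindex, Matrix.conjTranspose_kronecker]
    simp only [Matrix.reindex_apply, Matrix.submatrix_mul_equiv, ← Matrix.mul_kronecker_mul]
    simp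

lemma trace_bobMatrix (y : Y) : (P.bobMatrix y).trace = P.M.trace := by
  have hV := unitary_mul_conjTranspose (P.V y)
  unfold bobMatrix
  rw [Matrix.mul_assoc, Matrix.trace_mul_comm, Matrix.mul_assoc, hV, Matrix.mul_one]

lemma sum_norm_sq_bobMatrix_le (y : Y) :
    ∑ i, ∑ j, ‖P.bobMatrix y i j‖ ^ 2 ≤ 2 ^ (P.comm + P.priv) := by
  have hV := unitary_mul_conjTranspose (P.V y)
  have h := sum_norm_sq_conj ((P.V y : Matrix _ _ ℂ)ᴴ)
    (by rw [Matrix.conjTranspose_conjTranspose, hV]) P.M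
  rw [Matrix.conjTranspose_conjTranspose] at h
  unfold bobMatrix
  rw [h, sum_norm_sq_projection_eq P.isProjection]
  refine (trace_projection_re_le P.isProjection).trans (le_of_eq ?_)
  simp [pow_add]

lemma sum_norm_sq_aliceMatrix (x : X) :
    ∑ i, ∑ j, ‖P.aliceMatrix x i j‖ ^ 2 = 2 ^ (P.kept + P.comm) := by
  have hU := conjTranspose_mul_unitary (P.U x)
  unfold aliceMatrix
  rw [sum_norm_sq_conj _ hU]
  simp only [Matrix.diagonal_apply, apply_ite norm, norm_aliceSign, norm_zero, ite_pow, one_pow,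
    ne_eq, OfNat.ofNat_ne_zero, not_false_eq_true, zero_pow, Finset.sum_ite_eq, Finset.mem_univ,
    if_true, Finset.sum_const, Finset.card_univ]
  simp [pow_add]

/-- The operator on the message register that Alice's input determines. -/
def aliceReduced (x : X) (d c : Basis P.comm) : ℂ := ∑ k, P.aliceMatrix x (k, d) (k, c)

/-- The operator on the message register that Bob's input determines. -/
def bobReduced (y : Y) (c d : Basis P.comm) : ℂ :=
  ∑ q, P.bobMatrix y (c, q) (d, q) * P.bobSign q

/-- The part of the acceptance probability that does not depend on the inputs: it is the
probability of acceptance in the totally mixed state. -/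
noncomputable def baseProb : ℝ := P.M.trace.re / 2 ^ (P.comm + P.priv)

lemma baseProb_nonneg : 0 ≤ P.baseProb :=
  div_nonneg (trace_projection_re_nonneg P.isProjection) (by positivity)

lemma baseProb_le_one : P.baseProb ≤ 1 := by
  unfold baseProb
  rw [div_le_one (by positivity)]
  refine (trace_projection_re_le P.isProjection).trans (le_of_eq ?_)
  simp [pow_add]

lemma acceptProb_eq (x : X) (y : Y) : P.acceptProb x y = P.baseProb +
    (∑ c, ∑ d, P.bobReduced y c d * P.aliceReduced x d c).re /
      2 ^ (P.kept + P.comm + P.priv) := by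
  have h1 : (((1 : Matrix (Basis P.kept) (Basis P.kept) ℂ) ⊗ₖ P.M) * P.finalState x y).trace =
      ((1 : Matrix (Basis P.kept) (Basis P.kept) ℂ) ⊗ₖ P.bobMatrix y *
        (P.aliceOp x * P.initialState * (P.aliceOp x)ᴴ)).trace := by
    have h2 : P.finalState x y = P.bobOp y *
        ((P.aliceOp x * P.initialState * (P.aliceOp x)ᴴ) * (P.bobOp y)ᴴ) := by
      unfold finalState
      simp only [Matrix.conjTranspose_mul, Matrix.mul_assoc]
    have h3 : (1 : Matrix (Basis P.kept) (Basis P.kept) ℂ) ⊗ₖ P.bobMatrix y =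
        (P.bobOp y)ᴴ * ((1 : Matrix (Basis P.kept) (Basis P.kept) ℂ) ⊗ₖ P.M * P.bobOp y) := by
      unfold bobOp bobMatrix
      rw [Matrix.conjTranspose_kronecker, ← Matrix.mul_kronecker_mul, ← Matrix.mul_kronecker_mul,
        Matrix.mul_assoc]
      simp
    rw [h2, h3, ← Matrix.mul_assoc, ← Matrix.mul_assoc, Matrix.trace_mul_comm,
      ← Matrix.mul_assoc]
  unfold acceptProb
  rw [h1, conj_initialState, Matrix.mul_smul, Matrix.trace_smul, Matrix.mul_add, Matrix.mul_one,
    Matrix.trace_add, trace_kronecker_mul_reindex, Matrix.trace_kronecker, Matrix.trace_one,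
    trace_bobMatrix]
  have h4 : (1 / 2 ^ (P.kept + P.comm + P.priv) : ℂ) =
      ((1 / 2 ^ (P.kept + P.comm + P.priv) : ℝ) : ℂ) := by push_cast; rfl
  have h5 : ((Fintype.card (Basis P.kept) : ℕ) : ℂ) = ((2 ^ P.kept : ℝ) : ℂ) := by
    simp
  rw [smul_eq_mul, h4, h5, Complex.re_ofReal_mul, Complex.add_re, Complex.re_ofReal_mul, mul_add]
  unfold baseProb aliceReduced bobReduced
  congr 1
  · rw [add_assoc, pow_add]
    field_simp
  · rw [one_div, inv_mul_eq_div]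

lemma sum_norm_sq_bobReduced_le (y : Y) :
    ∑ c, ∑ d, ‖P.bobReduced y c d‖ ^ 2 ≤ 2 ^ P.comm * (2 ^ P.priv) ^ 2 := by
  refine (sum_norm_sq_partialTrace_le (P.bobMatrix y) P.bobSign P.norm_bobSign).trans ?_
  refine (mul_le_mul_of_nonneg_left (P.sum_norm_sq_bobMatrix_le y) (Nat.cast_nonneg _)).trans
    (le_of_eq ?_)
  simp
  ring

lemma sum_norm_sq_aliceReduced_le (x : X) :
    ∑ d, ∑ c, ‖P.aliceReduced x d c‖ ^ 2 ≤ 2 ^ P.comm * (2 ^ P.kept) ^ 2 := by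
  have h := sum_norm_sq_partialTrace_le
    ((P.aliceMatrix x).submatrix (Equiv.prodComm _ _) (Equiv.prodComm _ _)) (fun _ => 1)
    fun _ => norm_one
  simp only [mul_one, Matrix.submatrix_apply, Equiv.prodComm_apply, Prod.swap_prod_mk] at h
  refine h.trans (le_of_eq ?_)
  have h2 : ∑ i : Basis P.comm × Basis P.kept, ∑ j : Basis P.comm × Basis P.kept,
      ‖P.aliceMatrix x i.swap j.swap‖ ^ 2 = ∑ i, ∑ j, ‖P.aliceMatrix x i j‖ ^ 2 := by
    rw [← Equiv.sum_comp (Equiv.prodComm _ _) fun i => ∑ j, ‖P.aliceMatrix x i j‖ ^ 2]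
    refine Finset.sum_congr rfl fun i _ => ?_
    rw [← Equiv.sum_comp (Equiv.prodComm _ _) fun j => ‖P.aliceMatrix x _ j‖ ^ 2]
    rfl
  rw [h2, sum_norm_sq_aliceMatrix]
  simp
  ring

/-- Up to a constant, the acceptance probabilities of a protocol with one clean qubit are inner
products of real vectors of norm at most one. The vectors are the coordinates of the reduced
operators on the message register; that their norms do not grow with its size is the effect of
there being a single clean qubit. -/
theorem exists_vectors :
    ∃ (α : X → (Basis P.comm × Basis P.comm) ⊕ (Basis P.comm × Basis P.comm) → ℝ)
      (β : Y → (Basis P.comm × Basis P.comm) ⊕ (Basis P.comm × Basis P.comm) → ℝ),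
    (∀ x, ∑ i, α x i ^ 2 ≤ 1) ∧ (∀ y, ∑ i, β y i ^ 2 ≤ 1) ∧
      ∀ x y, P.acceptProb x y = P.baseProb + ∑ i, α x i * β y i := by
  set r : ℝ := Real.sqrt (2 ^ P.comm) with hr
  have hr2 : r ^ 2 = 2 ^ P.comm := Real.sq_sqrt (by positivity)
  have hr0 : 0 < r := Real.sqrt_pos.mpr (by positivity)
  refine ⟨fun x => Sum.elim (fun i => (P.aliceReduced x i.2 i.1).re / (r * 2 ^ P.kept))
      (fun i => -(P.aliceReduced x i.2 i.1).im / (r * 2 ^ P.kept)),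
    fun y => Sum.elim (fun i => (P.bobReduced y i.1 i.2).re / (r * 2 ^ P.priv))
      (fun i => (P.bobReduced y i.1 i.2).im / (r * 2 ^ P.priv)), fun x => ?_, fun y => ?_,
    fun x y => ?_⟩
  · have h := P.sum_norm_sq_aliceReduced_le x
    rw [Finset.sum_comm] at h
    simp only [Fintype.sum_sum_type, Sum.elim_inl, Sum.elim_inr, Fintype.sum_prod_type, div_pow,
      ← Finset.sum_div, ← add_div, ← Finset.sum_add_distrib, neg_sq]
    rw [div_le_one (by positivity), mul_pow, hr2]
    refine le_trans (le_of_eq ?_) h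
    refine Finset.sum_congr rfl fun c _ => Finset.sum_congr rfl fun d _ => ?_
    rw [← Complex.normSq_eq_norm_sq, Complex.normSq_apply]
    ring
  · have h := P.sum_norm_sq_bobReduced_le y
    simp only [Fintype.sum_sum_type, Sum.elim_inl, Sum.elim_inr, Fintype.sum_prod_type, div_pow,
      ← Finset.sum_div, ← add_div, ← Finset.sum_add_distrib]
    rw [div_le_one (by positivity), mul_pow, hr2]
    refine le_trans (le_of_eq ?_) h
    refine Finset.sum_congr rfl fun c _ => Finset.sum_congr rfl fun d _ => ?_
    rw [← Complex.normSq_eq_norm_sq, Complex.normSq_apply]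
    ring
  · rw [acceptProb_eq]
    congr 1
    have h : (2 : ℝ) ^ (P.kept + P.comm + P.priv) = (r * 2 ^ P.kept) * (r * 2 ^ P.priv) := by
      rw [pow_add, pow_add, ← hr2]
      ring
    simp only [Fintype.sum_sum_type, Sum.elim_inl, Sum.elim_inr, Fintype.sum_prod_type, h,
      Complex.re_sum, Finset.sum_div, ← Finset.sum_add_distrib]
    refine Finset.sum_congr rfl fun c _ => Finset.sum_congr rfl fun d _ => ?_
    rw [Complex.mul_re, div_mul_div_comm, div_mul_div_comm, ← add_div]
    ring

end OneWayProtocol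

/-! ### From weak correlation under every weight to a short list of sign pairs -/

lemma sgn_beq (a b : Bool) : sgn (a == b) = sgn a * sgn b := by
  cases a <;> cases b <;> simp [sgn]

section Boosting

variable {X Y : Type*} [Fintype X] [Fintype Y]

/-- One step of the exponential weight scheme: a pair with correlation `γ` decreases the total
weight by the factor `exp (-γ ^ 2 / 4)` when the weights are updated with rate `γ / 2`. -/
lemma exists_weight_decrease (f : X → Y → Bool) {γ : ℝ} (hγ0 : 0 < γ) (hγ1 : γ ≤ 1)
    (h : ∀ W : X → Y → ℝ, (∀ x y, 0 ≤ W x y) → ∃ (a : X → Bool) (b : Y → Bool),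
      γ * ∑ x, ∑ y, W x y ≤ ∑ x, ∑ y, W x y * (sgn (f x y) * (sgn (a x) * sgn (b y))))
    (W : X → Y → ℝ) (hW : ∀ x y, 0 ≤ W x y) :
    ∃ (a : X → Bool) (b : Y → Bool),
      ∑ x, ∑ y, W x y * Real.exp (-(γ / 2) * (sgn (f x y) * (sgn (a x) * sgn (b y)))) ≤
        Real.exp (-(γ ^ 2 / 4)) * ∑ x, ∑ y, W x y := by
  obtain ⟨a, b, hab⟩ := h W hW
  refine ⟨a, b, ?_⟩
  have h1 : ∀ x y, W x y * Real.exp (-(γ / 2) * (sgn (f x y) * (sgn (a x) * sgn (b y)))) ≤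
      W x y * (1 + γ ^ 2 / 4) -
        (γ / 2) * (W x y * (sgn (f x y) * (sgn (a x) * sgn (b y)))) := by
    intro x y
    set e := sgn (f x y) * (sgn (a x) * sgn (b y)) with he
    have he2 : e * e = 1 := by
      rw [he]
      linear_combination (sgn (a x) * sgn (b y)) ^ 2 * sgn_mul_self (f x y) +
        sgn (b y) ^ 2 * sgn_mul_self (a x) + sgn_mul_self (b y)
    have he1 : |e| = 1 := by rw [he, abs_mul, abs_mul, abs_sgn, abs_sgn, abs_sgn]; norm_num
    have h2 : |-(γ / 2) * e| ≤ 1 := by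
      rw [abs_mul, he1, abs_neg, abs_of_pos (by linarith)]
      linarith
    have h3 := (le_abs_self _).trans (Real.abs_exp_sub_one_sub_id_le h2)
    have h4 : (-(γ / 2) * e) ^ 2 = γ ^ 2 / 4 := by linear_combination (γ ^ 2 / 4) * he2
    have h5 := mul_le_mul_of_nonneg_left
      (show Real.exp (-(γ / 2) * e) ≤ 1 - γ / 2 * e + γ ^ 2 / 4 by linarith) (hW x y)
    linarith
  have h6 : 0 ≤ ∑ x, ∑ y, W x y :=
    Finset.sum_nonneg fun x _ => Finset.sum_nonneg fun y _ => hW x y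
  have h7 := mul_le_mul_of_nonneg_right (Real.add_one_le_exp (-(γ ^ 2 / 4))) h6
  calc _ ≤ ∑ x, ∑ y, (W x y * (1 + γ ^ 2 / 4) -
        (γ / 2) * (W x y * (sgn (f x y) * (sgn (a x) * sgn (b y))))) :=
        Finset.sum_le_sum fun x _ => Finset.sum_le_sum fun y _ => h1 x y
    _ = (∑ x, ∑ y, W x y) * (1 + γ ^ 2 / 4) -
        (γ / 2) * ∑ x, ∑ y, W x y * (sgn (f x y) * (sgn (a x) * sgn (b y))) := by
        simp only [Finset.sum_sub_distrib, ← Finset.sum_mul, ← Finset.mul_sum]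
    _ ≤ _ := by nlinarith

lemma exists_exp_sum_le (f : X → Y → Bool) {γ : ℝ} (hγ0 : 0 < γ) (hγ1 : γ ≤ 1)
    (h : ∀ W : X → Y → ℝ, (∀ x y, 0 ≤ W x y) → ∃ (a : X → Bool) (b : Y → Bool),
      γ * ∑ x, ∑ y, W x y ≤ ∑ x, ∑ y, W x y * (sgn (f x y) * (sgn (a x) * sgn (b y))))
    (N : ℕ) : ∃ (a : ℕ → X → Bool) (b : ℕ → Y → Bool),
      ∑ x, ∑ y, Real.exp (-(γ / 2) * ∑ i ∈ Finset.range N,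
        (sgn (f x y) * (sgn (a i x) * sgn (b i y)))) ≤
          Real.exp (-(γ ^ 2 / 4) * N) * (Fintype.card X * Fintype.card Y) := by
  induction N with
  | zero => exact ⟨fun _ _ => true, fun _ _ => true, by simp⟩
  | succ N ih =>
    obtain ⟨a, b, hab⟩ := ih
    obtain ⟨a', b', hab'⟩ := exists_weight_decrease f hγ0 hγ1 h
      (fun x y => Real.exp (-(γ / 2) * ∑ i ∈ Finset.range N,
        (sgn (f x y) * (sgn (a i x) * sgn (b i y))))) fun x y => (Real.exp_pos _).le
    refine ⟨Function.update a N a', Function.update b N b', ?_⟩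
    have h1 : ∀ x y, ∑ i ∈ Finset.range N, (sgn (f x y) *
        (sgn (Function.update a N a' i x) * sgn (Function.update b N b' i y))) =
        ∑ i ∈ Finset.range N, (sgn (f x y) * (sgn (a i x) * sgn (b i y))) := fun x y =>
      Finset.sum_congr rfl fun i hi => by
        rw [Function.update_of_ne (Finset.mem_range.mp hi).ne,
          Function.update_of_ne (Finset.mem_range.mp hi).ne]
    simp only [Finset.sum_range_succ, h1, Function.update_self, mul_add, Real.exp_add]
    refine hab'.trans ((mul_le_mul_of_nonneg_left hab (Real.exp_pos _).le).trans (le_of_eq ?_))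
    rw [← mul_assoc, ← Real.exp_add]
    congr 2
    push_cast
    ring

/-- If under every weight some pair of sign vectors has correlation `γ` with `f`, then a list of
`N = O(log (|X| |Y|) / γ ^ 2)` such pairs has average correlation `γ / 4` with `f` at every single
input. The exponential weights make the minimax theorem and the sampling of the list one step. -/
theorem exists_sgn_list (f : X → Y → Bool) {γ : ℝ} (hγ0 : 0 < γ) (hγ1 : γ ≤ 1)
    (h : ∀ W : X → Y → ℝ, (∀ x y, 0 ≤ W x y) → ∃ (a : X → Bool) (b : Y → Bool),
      γ * ∑ x, ∑ y, W x y ≤ ∑ x, ∑ y, W x y * (sgn (f x y) * (sgn (a x) * sgn (b y))))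
    {k : ℝ} (hk : (Fintype.card X * Fintype.card Y : ℝ) ≤ Real.exp k)
    {N : ℕ} (hN : 8 * k / γ ^ 2 ≤ N) :
    ∃ (a : ℕ → X → Bool) (b : ℕ → Y → Bool), ∀ x y,
      γ / 4 * N ≤ ∑ i ∈ Finset.range N, (sgn (f x y) * (sgn (a i x) * sgn (b i y))) := by
  obtain ⟨a, b, hab⟩ := exists_exp_sum_le f hγ0 hγ1 h N
  refine ⟨a, b, fun x y => ?_⟩
  set S := fun x y => ∑ i ∈ Finset.range N, (sgn (f x y) * (sgn (a i x) * sgn (b i y))) with hS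
  have h1 : Real.exp (-(γ / 2) * S x y) ≤ ∑ x, ∑ y, Real.exp (-(γ / 2) * S x y) :=
    (Finset.single_le_sum (f := fun y => Real.exp (-(γ / 2) * S x y))
      (fun _ _ => (Real.exp_pos _).le) (Finset.mem_univ y)).trans
    (Finset.single_le_sum (f := fun x => ∑ y, Real.exp (-(γ / 2) * S x y))
      (fun _ _ => Finset.sum_nonneg fun _ _ => (Real.exp_pos _).le) (Finset.mem_univ x))
  have h2 : Real.exp (-(γ / 2) * S x y) ≤ Real.exp (-(γ ^ 2 / 4) * N + k) := by
    rw [Real.exp_add]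
    exact h1.trans (hab.trans (mul_le_mul_of_nonneg_left hk (Real.exp_pos _).le))
  rw [Real.exp_le_exp] at h2
  rw [div_le_iff₀ (by positivity)] at hN
  change γ / 4 * N ≤ S x y
  nlinarith

end Boosting

/-! ### The private coin protocol -/

namespace ProtocolTree

variable {S T : Type}

/-- Alice sends the `l` lowest binary digits of the number `g s`; the players then continue with
the protocol that belongs to the number sent. -/
def sendNat : ℕ → (S → ℕ) → (ℕ → ProtocolTree S T) → ProtocolTree S T
  | 0, _, t => t 0
  | l + 1, g, t => alice (fun s => decide (g s % 2 = 1))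
      (sendNat l (fun s => g s / 2) fun k => t (2 * k))
      (sendNat l (fun s => g s / 2) fun k => t (2 * k + 1))

lemma run_sendNat (l : ℕ) (g : S → ℕ) (t : ℕ → ProtocolTree S T) (s : S) (u : T) :
    g s < 2 ^ l → (sendNat l g t).run s u = (t (g s)).run s u := by
  induction l generalizing g t with
  | zero =>
    intro h
    have h0 : g s = 0 := by simpa using h
    rw [h0]
    rfl
  | succ l ih =>
    intro h
    have h2 : g s / 2 < 2 ^ l := by rw [pow_succ] at h; omega
    unfold sendNat
    rw [run]
    by_cases hb : g s % 2 = 1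
    · rw [if_pos (by simpa using hb), ih _ _ h2]
      congr 2
      omega
    · rw [if_neg (by simpa using hb), ih _ _ h2]
      congr 2
      omega

lemma height_sendNat_le (l m : ℕ) (g : S → ℕ) (t : ℕ → ProtocolTree S T)
    (h : ∀ k, (t k).height ≤ m) : (sendNat l g t).height ≤ l + m := by
  induction l generalizing g t with
  | zero => simpa [sendNat] using h 0
  | succ l ih =>
    have h0 := ih (fun s => g s / 2) (fun k => t (2 * k)) fun k => h _
    have h1 := ih (fun s => g s / 2) (fun k => t (2 * k + 1)) fun k => h _
    simp only [sendNat, height]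
    omega

/-- Both players send one bit; the output tells whether the bits agree. -/
def compare (a : S → Bool) (b : T → Bool) : ProtocolTree S T :=
  alice a (bob b (leaf true) (leaf false)) (bob b (leaf false) (leaf true))

lemma run_compare (a : S → Bool) (b : T → Bool) (s : S) (u : T) :
    (compare a b).run s u = (a s == b u) := by
  simp only [compare, run]
  cases a s <;> cases b u <;> rfl

lemma height_compare (a : S → Bool) (b : T → Bool) : (compare a b).height = 2 := rfl

end ProtocolTree

section Protocol

variable {X Y : Type}

/-- The protocol in which Alice draws an index `i < N`, sends its `l` binary digits, and the
players then compare the bits `a i x` and `b i y`. Bob draws no coins: his sample space is a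
single point. -/
noncomputable def listProtocol (N l : ℕ) (hN : 0 < N) (a : ℕ → X → Bool) (b : ℕ → Y → Bool) :
    PrivateCoinProtocol X Y where
  coinsA := N
  coinsB := 1
  distA _ := 1 / N
  distB _ := 1
  distA_mem := by
    refine ⟨fun _ => by positivity, ?_⟩
    have : (N : ℝ) ≠ 0 := by positivity
    simp [this]
  distB_mem := ⟨fun _ => zero_le_one, by simp⟩
  tree := ProtocolTree.sendNat l (fun s => s.2) fun i =>
    ProtocolTree.compare (fun s => a i s.1) fun t => b i t.1

lemma height_listProtocol_le (N l : ℕ) (hN : 0 < N) (a : ℕ → X → Bool) (b : ℕ → Y → Bool) :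
    (listProtocol N l hN a b).tree.height ≤ l + 2 :=
  ProtocolTree.height_sendNat_le _ _ _ _ fun _ => le_of_eq (ProtocolTree.height_compare _ _)

lemma outputProb_listProtocol (N l : ℕ) (hN : 0 < N) (hl : N ≤ 2 ^ l) (a : ℕ → X → Bool)
    (b : ℕ → Y → Bool) (x : X) (y : Y) (z : Bool) :
    (listProtocol N l hN a b).outputProb x y z =
      1 / 2 + (∑ i ∈ Finset.range N, (sgn z * (sgn (a i x) * sgn (b i y)))) / (2 * N) := by
  have hN' : (N : ℝ) ≠ 0 := by positivity
  have h1 : ∀ r : Fin N, ∀ s : Fin 1,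
      (listProtocol N l hN a b).tree.run (x, r) (y, s) = (a r x == b r y) := fun r s => by
    exact (ProtocolTree.run_sendNat l _ _ (x, r) (y, s) (r.2.trans_le hl)).trans
      (ProtocolTree.run_compare _ _ _ _)
  have h2 : ∀ w : Bool, (if w = z then (1 : ℝ) else 0) = 1 / 2 + (sgn z * sgn w) / 2 := fun w => by
    cases w <;> cases z <;> norm_num [sgn]
  have h3 : (listProtocol N l hN a b).outputProb x y z = ∑ r : Fin N, ∑ _s : Fin 1,
      1 / (N : ℝ) * 1 * (if (a r x == b r y) = z then 1 else 0) :=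
    Finset.sum_congr rfl fun r _ => Finset.sum_congr rfl fun s _ =>
      congrArg (fun w => 1 / (N : ℝ) * 1 * if w = z then (1 : ℝ) else 0) (h1 r s)
  rw [h3]
  simp only [h2, sgn_beq, Finset.sum_const, Finset.card_univ, Fintype.card_fin, one_smul, mul_one]
  rw [← Finset.mul_sum, Finset.sum_add_distrib, Finset.sum_const, Finset.card_univ,
    Fintype.card_fin, nsmul_eq_mul, ← Finset.sum_div,
    Fin.sum_univ_eq_sum_range (fun i => sgn z * (sgn (a i x) * sgn (b i y))) N]
  field_simp

lemma outputProb_le_one (P : PrivateCoinProtocol X Y) (x : X) (y : Y) (z : Bool) :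
    P.outputProb x y z ≤ 1 := by
  have hA := P.distA_mem
  have hB := P.distB_mem
  calc P.outputProb x y z ≤ ∑ r, ∑ s, P.distA r * P.distB s := by
        refine Finset.sum_le_sum fun r _ => Finset.sum_le_sum fun s _ => ?_
        refine mul_le_of_le_one_right (mul_nonneg (hA.1 r) (hB.1 s)) ?_
        split <;> norm_num
    _ = 1 := by simp only [← Finset.mul_sum, hB.2, mul_one, hA.2]

/-- The costs over which `PP f` is the infimum are bounded below, so any protocol bounds it. -/
lemma PP_le [Nonempty X] [Nonempty Y] {f : X → Y → Bool} (P : PrivateCoinProtocol X Y) {ε : ℝ}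
    (h : P.ComputesWithBias f ε) : PP f ≤ (P.tree.height : ℤ) - ⌊Real.logb 2 ε⌋ := by
  refine csInf_le ⟨0, ?_⟩ ⟨P, ε, h, rfl⟩
  rintro k ⟨Q, δ, ⟨hδ, hQ⟩, rfl⟩
  obtain ⟨x⟩ := ‹Nonempty X›
  obtain ⟨y⟩ := ‹Nonempty Y›
  have h1 : δ ≤ 1 := by linarith [hQ x y, outputProb_le_one Q x y (f x y)]
  have h2 : Real.logb 2 δ ≤ 0 := Real.logb_nonpos (by norm_num) hδ.le h1
  have h3 : ⌊Real.logb 2 δ⌋ ≤ 0 := by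
    have := (Int.floor_le (Real.logb 2 δ)).trans h2
    exact_mod_cast this
  omega

end Protocol

/-! ### The lower bound -/

section Main

variable {X Y : Type}

/-- A protocol with bias `ε` forces `f` to correlate with a sign matrix of rank one under every
weight. The vectors of `exists_vectors` separate the inputs with margin `ε` around a threshold
`τ`. Either their inner products or the constant `τ` account for half of the margin on average;
in the former case the truncation level `4 / ε` loses only half of what there is. -/
lemma exists_sgn_of_computesWithBias [Fintype X] [Fintype Y] {f : X → Y → Bool}
    (P : OneWayProtocol X Y) {ε : ℝ} (h : P.ComputesWithBias f ε) (W : X → Y → ℝ)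
    (hW : ∀ x y, 0 ≤ W x y) : ∃ (a : X → Bool) (b : Y → Bool),
      ε ^ 3 / 64 * ∑ x, ∑ y, W x y ≤
        ∑ x, ∑ y, W x y * (sgn (f x y) * (sgn (a x) * sgn (b y))) := by
  obtain ⟨hε, p, hp0, hp1, hf⟩ := h
  obtain ⟨α, β, hα, hβ, hP⟩ := P.exists_vectors
  set τ : ℝ := p - P.baseProb with hτ
  have hq0 := P.baseProb_nonneg
  have hq1 := P.baseProb_le_one
  have hτ1 : |τ| ≤ 1 := abs_le.mpr ⟨by linarith, by linarith⟩
  have hε1 : ε ≤ 1 / 2 := by linarith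
  have hW0 : 0 ≤ ∑ x, ∑ y, W x y :=
    Finset.sum_nonneg fun x _ => Finset.sum_nonneg fun y _ => hW x y
  have hcube : ε ^ 3 / 64 ≤ ε / 2 := by nlinarith [sq_nonneg ε]
  have hmargin : ∀ x y, ε ≤ sgn (f x y) * (∑ i, α x i * β y i - τ) := by
    intro x y
    have h1 := hf x y
    have h2 := hP x y
    cases hxy : f x y
    · have := h1.1 hxy
      rw [show sgn false = -1 from rfl]
      linarith
    · have := h1.2 hxy
      rw [show sgn true = 1 from rfl]
      linarith
  set G : X → Y → ℝ := fun x y => W x y * sgn (f x y) with hG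
  have hsum : ε * ∑ x, ∑ y, W x y ≤
      ∑ x, ∑ y, G x y * ∑ i, α x i * β y i - τ * ∑ x, ∑ y, G x y := by
    rw [Finset.mul_sum, Finset.mul_sum, ← Finset.sum_sub_distrib]
    refine Finset.sum_le_sum fun x _ => ?_
    rw [Finset.mul_sum, Finset.mul_sum, ← Finset.sum_sub_distrib]
    refine Finset.sum_le_sum fun y _ => ?_
    have := mul_le_mul_of_nonneg_left (hmargin x y) (hW x y)
    simp only [hG]
    linarith
  have habs : ∑ x, ∑ y, |G x y| = ∑ x, ∑ y, W x y := by
    simp only [hG, abs_mul, abs_sgn, mul_one, abs_of_nonneg (hW _ _)]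
  simp only [← mul_assoc (W _ _)]
  rcases le_or_gt (ε / 2 * ∑ x, ∑ y, W x y) (∑ x, ∑ y, G x y * ∑ i, α x i * β y i) with h1 | h1
  · obtain ⟨a, b, hab⟩ := exists_sgn_sum_inner_le (T := 4 / ε) (by positivity) G α β hα hβ
    refine ⟨a, b, ?_⟩
    rw [habs] at hab
    have h2 : (∑ x, ∑ y, W x y) / (4 / ε) = ε / 4 * ∑ x, ∑ y, W x y := by field_simp
    have h3 : ε / 4 * ∑ x, ∑ y, W x y ≤
        (4 / ε) ^ 2 * ∑ x, ∑ y, G x y * (sgn (a x) * sgn (b y)) := by linarith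
    have h4 := mul_le_mul_of_nonneg_left h3 (show 0 ≤ ε ^ 2 / 16 by positivity)
    have h5 : ε ^ 2 / 16 * ((4 / ε) ^ 2 * ∑ x, ∑ y, G x y * (sgn (a x) * sgn (b y))) =
        ∑ x, ∑ y, G x y * (sgn (a x) * sgn (b y)) := by field_simp; ring
    rw [h5] at h4
    refine le_trans (le_of_eq ?_) h4
    ring
  · have h2 : ε / 2 * ∑ x, ∑ y, W x y ≤ |∑ x, ∑ y, G x y| := by
      have h3 : -τ * ∑ x, ∑ y, G x y ≤ 1 * |∑ x, ∑ y, G x y| := by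
        refine (le_abs_self _).trans ?_
        rw [abs_mul, abs_neg]
        exact mul_le_mul_of_nonneg_right hτ1 (abs_nonneg _)
      linarith
    have h3 := mul_le_mul_of_nonneg_right hcube hW0
    rcases abs_cases (∑ x, ∑ y, G x y) with ⟨h4, -⟩ | ⟨h4, -⟩
    · refine ⟨fun _ => true, fun _ => true, ?_⟩
      have h5 : ∑ x, ∑ y, W x y * sgn (f x y) * (sgn true * sgn true) = ∑ x, ∑ y, G x y := by
        simp [hG, sgn]
      rw [h5]
      linarith
    · refine ⟨fun _ => true, fun _ => false, ?_⟩
      have h5 : ∑ x, ∑ y, W x y * sgn (f x y) * (sgn true * sgn false) = -∑ x, ∑ y, G x y := by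
        simp [hG, sgn, Finset.sum_neg_distrib]
      rw [h5]
      linarith

/-- `PP f` is at most logarithmic in the input length and in the inverse of the bias of a protocol
with one clean qubit, independently of the amount of communication. -/
theorem PP_le_of_computesWithBias {n : ℕ} (hn : 1 ≤ n)
    {f : (Fin n → Bool) → (Fin n → Bool) → Bool} (P : OneWayProtocol (Fin n → Bool) (Fin n → Bool))
    {ε : ℝ} (h : P.ComputesWithBias f ε) :
    (PP f : ℝ) ≤ 30 + Real.logb 2 n - 9 * Real.logb 2 ε := by
  have hε : 0 < ε := h.1
  have hε1 : ε ≤ 1 / 2 := by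
    obtain ⟨-, p, h1, h2, -⟩ := h
    linarith
  have hn1 : (1 : ℝ) ≤ n := by exact_mod_cast hn
  set γ : ℝ := ε ^ 3 / 64 with hγ
  have hγ0 : 0 < γ := by positivity
  have hγ1 : γ ≤ 1 := by
    have : ε ^ 3 ≤ 1 := pow_le_one₀ hε.le (by linarith)
    linarith
  have hk : (Fintype.card (Fin n → Bool) * Fintype.card (Fin n → Bool) : ℝ) ≤
      Real.exp (2 * n) := by
    have h2 : (2 : ℝ) ≤ Real.exp 1 := by linarith [Real.add_one_le_exp (1 : ℝ)]
    have h3 : (2 : ℝ) ^ n ≤ Real.exp n := by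
      calc (2 : ℝ) ^ n ≤ Real.exp 1 ^ n := pow_le_pow_left₀ (by norm_num) h2 n
        _ = Real.exp n := by rw [← Real.exp_nat_mul, mul_one]
    simp only [Fintype.card_fun, Fintype.card_bool, Fintype.card_fin]
    push_cast
    rw [two_mul, Real.exp_add]
    exact mul_le_mul h3 h3 (by positivity) (Real.exp_pos _).le
  set N : ℕ := ⌈8 * (2 * n) / γ ^ 2⌉₊ with hN
  have hN1 : 8 * (2 * n) / γ ^ 2 ≤ N := Nat.le_ceil _
  have hbase : (1 : ℝ) ≤ 8 * (2 * n) / γ ^ 2 := by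
    rw [le_div_iff₀ (by positivity)]
    nlinarith [pow_le_one₀ hγ0.le hγ1 (n := 2)]
  have hN2 : (N : ℝ) ≤ 32 * n / γ ^ 2 := by
    have h1 := (Nat.ceil_lt_add_one (show (0 : ℝ) ≤ 8 * (2 * n) / γ ^ 2 by positivity)).le
    have h2 : 32 * n / γ ^ 2 = 8 * (2 * n) / γ ^ 2 + 8 * (2 * n) / γ ^ 2 := by ring
    rw [h2]
    linarith
  have hN0 : 0 < N := by
    have : (0 : ℝ) < N := by linarith
    exact_mod_cast this
  obtain ⟨a, b, hab⟩ := exists_sgn_list f hγ0 hγ1 (exists_sgn_of_computesWithBias P h) hk hN1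
  set l : ℕ := Nat.clog 2 N with hl
  have hl1 : N ≤ 2 ^ l := Nat.le_pow_clog (by norm_num) N
  have hbias : (listProtocol N l hN0 a b).ComputesWithBias f (γ / 8) := by
    refine ⟨by positivity, fun x y => ?_⟩
    rw [outputProb_listProtocol N l hN0 hl1]
    have hN' : (0 : ℝ) < N := by exact_mod_cast hN0
    have h1 := hab x y
    rw [add_le_add_iff_left, le_div_iff₀ (by positivity)]
    linarith
  have hPP := PP_le _ hbias
  have hheight := height_listProtocol_le N l hN0 a b
  have hPP' : (PP f : ℝ) ≤ (l + 2) - (⌊Real.logb 2 (γ / 8)⌋ : ℝ) := by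
    have h1 : PP f ≤ ((l + 2 : ℕ) : ℤ) - ⌊Real.logb 2 (γ / 8)⌋ := by
      have : ((listProtocol N l hN0 a b).tree.height : ℤ) ≤ ((l + 2 : ℕ) : ℤ) := by
        exact_mod_cast hheight
      linarith
    exact_mod_cast h1
  have hl2 : (l : ℝ) ≤ Real.logb 2 N + 1 := by
    have h1 := Real.natLog_le_logb N 2
    have h2 : l ≤ Nat.log 2 N + 1 := by
      rw [hl]
      refine Nat.clog_le_of_le_pow ?_
      exact (Nat.lt_pow_succ_log_self (by norm_num) N).le
    have h3 : (l : ℝ) ≤ Nat.log 2 N + 1 := by exact_mod_cast h2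
    push_cast at h1
    linarith
  have hlogN : Real.logb 2 N ≤ 5 + Real.logb 2 n - 2 * Real.logb 2 γ := by
    have h1 : Real.logb 2 N ≤ Real.logb 2 (32 * n / γ ^ 2) :=
      Real.logb_le_logb_of_le (by norm_num) (by exact_mod_cast hN0) hN2
    have h2 : Real.logb 2 (32 * n / γ ^ 2) = 5 + Real.logb 2 n - 2 * Real.logb 2 γ := by
      rw [Real.logb_div (by positivity) (by positivity), Real.logb_mul (by norm_num) (by positivity),
        Real.logb_pow, show (32 : ℝ) = 2 ^ 5 by norm_num, Real.logb_pow,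
        Real.logb_self_eq_one (by norm_num)]
      norm_num
    linarith
  have hlogγ : Real.logb 2 γ = 3 * Real.logb 2 ε - 6 := by
    rw [hγ, Real.logb_div (by positivity) (by positivity), Real.logb_pow,
      show (64 : ℝ) = 2 ^ 6 by norm_num, Real.logb_pow, Real.logb_self_eq_one (by norm_num)]
    norm_num
  have hlogγ8 : Real.logb 2 (γ / 8) = Real.logb 2 γ - 3 := by
    rw [Real.logb_div (by positivity) (by positivity), show (8 : ℝ) = 2 ^ 3 by norm_num,
      Real.logb_pow, Real.logb_self_eq_one (by norm_num)]
    norm_num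
  have hfloor := Int.sub_one_lt_floor (Real.logb 2 (γ / 8))
  linarith

end Main

end OneCleanQubit

theorem mainTheorem3 :
    ∃ a b : ℝ, 0 < a ∧ 0 < b ∧
      ∀ n : ℕ, 1 ≤ n → ∀ f : (Fin n → Bool) → (Fin n → Bool) → Bool,
        ENNReal.ofReal ((2 : ℝ) ^ (a * (OneCleanQubit.PP f : ℝ) - b * Real.logb 2 (n : ℝ))) ≤
          OneCleanQubit.oneWayCost f := by
  -- As `ε ≤ 1 / 2`, the bound on `PP f` is at most `logb 2 n + 39 * logb 2 (1 / ε)`.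
  refine ⟨2 / 39, 2 / 39, by norm_num, by norm_num, fun n hn f => ?_⟩
  refine le_iInf fun P => le_iInf fun ε => le_iInf fun h => ENNReal.ofReal_le_ofReal ?_
  have hPP := OneCleanQubit.PP_le_of_computesWithBias hn P h
  have hε : 0 < ε := h.1
  have hε1 : ε ≤ 1 / 2 := by
    obtain ⟨-, p, h1, h2, -⟩ := h
    linarith
  have hlog : Real.logb 2 ε ≤ -1 := by
    have h1 := Real.logb_le_logb_of_le (b := 2) (by norm_num) hε hε1
    have h2 : Real.logb 2 (1 / 2) = -1 := by
      rw [one_div, Real.logb_inv, Real.logb_self_eq_one (by norm_num)]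
    linarith
  have hcomm : (1 : ℝ) ≤ P.comm := by exact_mod_cast P.one_le_comm
  calc (2 : ℝ) ^ (2 / 39 * (OneCleanQubit.PP f : ℝ) - 2 / 39 * Real.logb 2 (n : ℝ))
      ≤ (2 : ℝ) ^ (-2 * Real.logb 2 ε) :=
        Real.rpow_le_rpow_of_exponent_le (by norm_num) (by linarith)
    _ = 1 / ε ^ 2 := by
        rw [mul_comm, Real.rpow_mul (by norm_num), Real.rpow_logb (by norm_num) (by norm_num) hε,
          Real.rpow_neg hε.le, one_div]
        norm_num
    _ ≤ (P.comm : ℝ) / ε ^ 2 := by gcongr
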